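/- A (strict) cyclic order on an abelian group $(G,+)$ is a ternary relation $R$ such that, for all $a,b,c,u\in G$: $R(a,b,c)$ implies that $a,b,c$ are pairwise distinct; $R(a,b,c)$ implies $R(b,c,a)$; $R(c,\cdot,\cdot)$ is a strict linear order on $G\setminus\{c\}$; and $R(a,b,c)$ implies $R(u+a,u+b,u+c)$. Then $(G,R)$ is called an abelian cyclically ordered group. Write $R(y_1,\dots,y_m)$ if $R(y_i,y_j,y_k)$ holds for all $1\le i<j<k\le m$. We say that $(G,R)$ is linearly cyclically ordered if there is a linear order $<$ on $G$, compatible with the addition, such that $R(a,b,c)$ holds if and only if $a<b<c$ or $b<c<a$ or $c<a<b$; this order $<$ is then unique. Let $n\ge 2$. The cyclically ordered group $(G,R)$ is $n$-regular if for all $x_1,\dots,x_n\in G$ with $R(0,x_1,\dots,x_n,-x_n)$ there is $x\in G$ such that ($R(x_1,nx,x_n)$ or $nx=x_1$ or $nx=x_n$) and $R(0,x,2x,\dots,(n-1)x,x_n)$. It is c-$n$-regular if the same conclusion holds for all $x_1,\dots,x_n\in G$ with $R(0,x_1,\dots,x_n)$. A linearly ordered abelian group is $n$-regular if for all $0<x_1<\dots<x_n$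 in it there is an element $y$ with $x_1\le ny\le x_n$. **Theorem.** Let $n\ge 2$ and let $(G,R)$ be an abelian cyclically ordered group. Then $(G,R)$ is $n$-regular if and only if one of the following two conditions holds: 1. $(G,R)$ is linearly cyclically ordered, and $G$ with the corresponding linear order is an $n$-regular linearly ordered group; 2. $(G,R)$ is not linearly cyclically ordered, and it is c-$n$-regular. In other words, the class of $n$-regular abelian cyclically ordered groups is the union of the class of linearly cyclically ordered abelian groups whose linear order is $n$-regular and of the class of c-$n$-regular abelian cyclically ordered groups: $(G,R)$ is $n$-regular if and only if it is linearly cyclically ordered with an $n$-regular linear order, or it is c-$n$-regular. -/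

import Mathlib

namespace CyclicOrd

/-- An abelian cyclically ordered group: the (strict) cyclic order `R` is the relation `sbtw` of
Mathlib's `CircularOrder`, and it is compatible with the addition. -/
class IsCyclicallyOrderedAddGroup (G : Type*) [AddCommGroup G] [CircularOrder G] : Prop where
  sbtw_add_left : ∀ u a b c : G, sbtw a b c → sbtw (u + a) (u + b) (u + c)

/-- `R(y₁, …, yₘ)`: every triple `yᵢ, yⱼ, yₖ` with `i < j < k` satisfies `R(yᵢ, yⱼ, yₖ)`. -/
def CycChain {G : Type*} [CircularOrder G] (l : List G) : Prop :=
  l.Triplewise sbtw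

/-- The common conclusion of the two notions of regularity for `(x₁, xₙ) = (a, b)`: there is `x`
with (`R(a, nx, b)` or `nx = a` or `nx = b`) and `R(0, x, 2x, …, (n-1)x, b)`. -/
def HasCycDivision {G : Type*} [AddCommGroup G] [CircularOrder G] (n : ℕ) (a b : G) : Prop :=
  ∃ x : G, (sbtw a (n • x) b ∨ n • x = a ∨ n • x = b) ∧
    CycChain ((List.range n).map (fun k => k • x) ++ [b])

/-- `n`-regular cyclically ordered group: the hypothesis is `R(0, x₁, …, xₙ, -xₙ)`.
Only the terms `x 1, …, x n` of the sequence `x` matter. -/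
def IsNRegular (G : Type*) [AddCommGroup G] [CircularOrder G] (n : ℕ) : Prop :=
  ∀ x : ℕ → G, CycChain ([0] ++ (List.range' 1 n).map x ++ [-x n]) →
    HasCycDivision n (x 1) (x n)

/-- c-`n`-regular cyclically ordered group: the hypothesis is `R(0, x₁, …, xₙ)`.
Only the terms `x 1, …, x n` of the sequence `x` matter. -/
def IsCNRegular (G : Type*) [AddCommGroup G] [CircularOrder G] (n : ℕ) : Prop :=
  ∀ x : ℕ → G, CycChain ([0] ++ (List.range' 1 n).map x) →
    HasCycDivision n (x 1) (x n)

/-- `n`-regular linearly ordered abelian group: if `0 < x₁ < ⋯ < xₙ`, then there is `y` with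
`x₁ ≤ ny ≤ xₙ`. -/
def IsNRegularLinear (G : Type*) [AddCommGroup G] [LinearOrder G] (n : ℕ) : Prop :=
  ∀ x : ℕ → G, 0 < x 1 → (∀ i, 1 ≤ i → i < n → x i < x (i + 1)) →
    ∃ y : G, x 1 ≤ n • y ∧ n • y ≤ x n

/-- The linear order on `G` is a group order, and the cyclic order of `G` is the one it induces. -/
structure IsInducedByLinearOrder (G : Type*) [AddCommGroup G] [CircularOrder G]
    [LinearOrder G] : Prop where
  isOrdered : IsOrderedAddMonoid G
  sbtw_iff : ∀ a b c : G,
    sbtw a b c ↔ (a < b ∧ b < c) ∨ (b < c ∧ c < a) ∨ (c < a ∧ a < b)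

/-- `G` is linearly cyclically ordered. -/
def IsLinearlyCyclicallyOrdered (G : Type*) [AddCommGroup G] [CircularOrder G] : Prop :=
  ∃ _ : LinearOrder G, IsInducedByLinearOrder G

/-- `G` is linearly cyclically ordered and is an `n`-regular linearly ordered group. (The linear
order is unique: an element `x ≠ 0` is positive if and only if `R(0, x, 2x)`.) -/
def IsNRegularLinearlyOrdered (G : Type*) [AddCommGroup G] [CircularOrder G] (n : ℕ) : Prop :=
  ∃ _ : LinearOrder G, IsInducedByLinearOrder G ∧ IsNRegularLinear G n

end CyclicOrd

namespace CyclicOrd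

/-! Work in `Unwound G`, a linearly ordered group with quotient `G` by the subgroup generated by
`turn G`. There c-`n`-regularity follows from divisibility for sequences below the full turn
(`DivisibleBelow`), while `n`-regularity gives it below half a turn (`DivisibleBelowHalf`), since
the extra term `-xₙ` amounts to `2xₙ < turn`.

If some `g` and its complement `turn - g` are both non-infinitesimal, the half bound implies the
full one (`DivisibleBelowHalf.divisibleBelow`): a counterexample makes every `w ≥ 0` with `nw < x₁`
infinitesimal, but dividing near `g` produces such a `w` that is not. If there is no such `g`, the
infinitesimals form the positive cone of a linear order inducing the cyclic one
(`isLinearlyCyclicallyOrdered_of_infinitesimal`). In the linear case the term `-xₙ` only forces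
positivity. -/

theorem le_of_forall_lt_succ {U : Type*} [Preorder U] {n : ℕ} {x : ℕ → U}
    (hx : ∀ i, 1 ≤ i → i < n → x i < x (i + 1)) {i j : ℕ} (hi : 1 ≤ i) (hij : i ≤ j)
    (hj : j ≤ n) : x i ≤ x j := by
  induction j, hij using Nat.le_induction with
  | base => exact le_rfl
  | succ j hij ih => exact (ih (by omega)).trans (hx j (by omega) (by omega)).le

theorem lt_of_forall_lt_succ {U : Type*} [Preorder U] {n : ℕ} {x : ℕ → U}
    (hx : ∀ i, 1 ≤ i → i < n → x i < x (i + 1)) {i j : ℕ} (hi : 1 ≤ i) (hij : i < j)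
    (hj : j ≤ n) : x i < x j :=
  (hx i hi (by omega)).trans_le (le_of_forall_lt_succ hx (by omega) hij hj)

/-! ### Linearly ordered groups: from half the interval to all of it. -/

section OrderedGroup

variable {U : Type*} [AddCommGroup U] [LinearOrder U]

/-- The linearly ordered counterpart of `n`-regularity, below the bound `z`. -/
def DivisibleBelow (n : ℕ) (z : U) : Prop :=
  ∀ x : ℕ → U, 0 < x 1 → (∀ i, 1 ≤ i → i < n → x i < x (i + 1)) → x n < z →
    ∃ y, x 1 ≤ n • y ∧ n • y ≤ x n

/-- As `DivisibleBelow`, for sequences in the lower half of the interval. -/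
def DivisibleBelowHalf (n : ℕ) (z : U) : Prop :=
  ∀ x : ℕ → U, 0 < x 1 → (∀ i, 1 ≤ i → i < n → x i < x (i + 1)) → 2 • x n < z →
    ∃ y, x 1 ≤ n • y ∧ n • y ≤ x n

/-- All multiples of `w` are below `z`. -/
def Infinitesimal (z w : U) : Prop := ∀ k : ℕ, k • w < z

theorem Infinitesimal.nsmul {z w : U} (hw : Infinitesimal z w) (m : ℕ) :
    Infinitesimal z (m • w) := fun k => by
  rw [← mul_nsmul']; exact hw _

variable [IsOrderedAddMonoid U]

theorem Infinitesimal.of_le {z v w : U} (hw : Infinitesimal z w) (h : v ≤ w) :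
    Infinitesimal z v :=
  fun k => (nsmul_le_nsmul_right h k).trans_lt (hw k)

theorem Infinitesimal.add {z v w : U} (hv : Infinitesimal z v) (hw : Infinitesimal z w) :
    Infinitesimal z (v + w) := by
  rcases le_total v w with h | h
  · exact (hw.nsmul 2).of_le (by rw [two_nsmul]; gcongr)
  · exact (hv.nsmul 2).of_le (by rw [two_nsmul]; gcongr)

/-- Take for `d` the least of `x 1` and the successive gaps, which sum to `x n`. -/
theorem exists_pos_nsmul_le {n : ℕ} {x : ℕ → U} (h0 : 0 < x 1)
    (hx : ∀ i, 1 ≤ i → i < n → x i < x (i + 1)) (hn : 1 ≤ n) : ∃ d, 0 < d ∧ n • d ≤ x n := by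
  induction n, hn using Nat.le_induction with
  | base => exact ⟨x 1, h0, by simp⟩
  | succ n hn ih =>
    obtain ⟨d, hd, hle⟩ := ih fun i hi hin => hx i hi (by omega)
    refine ⟨min d (x (n + 1) - x n), lt_min hd (sub_pos.2 (hx n hn (by omega))), ?_⟩
    rw [succ_nsmul]
    calc n • min d (x (n + 1) - x n) + min d (x (n + 1) - x n)
        ≤ n • d + (x (n + 1) - x n) :=
          add_le_add (nsmul_le_nsmul_right (min_le_left _ _) n) (min_le_right _ _)
      _ ≤ x n + (x (n + 1) - x n) := by gcongr
      _ = x (n + 1) := by abel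

theorem Infinitesimal.lt {z d g : U} (hd : Infinitesimal z d) (hg : ¬ Infinitesimal z g) :
    d < g := lt_of_not_ge fun h => hg (hd.of_le h)

theorem DivisibleBelowHalf.double_lt {n : ℕ} {z : U} (hreg : DivisibleBelowHalf n z)
    {x : ℕ → U} (hx : ∀ i, 1 ≤ i → i < n → x i < x (i + 1)) (hxz : x n < z)
    (hno : ¬ ∃ y, x 1 ≤ n • y ∧ n • y ≤ x n) {w : U} (hw : n • w < x 1) :
    n • (2 • w) < x 1 := by
  -- Otherwise the sequence shifted down by `n • w` meets the half bound, and its quotient plus `w`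
  -- contradicts `hno`.
  have hz : z ≤ 2 • (x n - n • w) := by
    by_contra! hz
    obtain ⟨y, hy1, hy2⟩ := hreg (fun i => x i - n • w) (sub_pos.2 hw)
      (fun i hi hin => sub_lt_sub_right (hx i hi hin) _) hz
    refine hno ⟨y + w, ?_, ?_⟩ <;> rw [nsmul_add]
    · exact sub_le_iff_le_add.1 hy1
    · exact le_sub_iff_add_le.1 hy2
  -- By `hz`, `n • (2 • w) ≤ 2 • x n - z < x n`, so this multiple would lie in the forbidden
  -- interval.
  by_contra! h
  have h2 : x n < n • (2 • w) := lt_of_not_ge fun h' => hno ⟨_, h, h'⟩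
  rw [nsmul_left_comm] at h2
  rw [nsmul_sub, two_nsmul (x n)] at hz
  grind

theorem DivisibleBelowHalf.infinitesimal {n : ℕ} (hn : 1 ≤ n) {z : U}
    (hreg : DivisibleBelowHalf n z) {x : ℕ → U}
    (hx : ∀ i, 1 ≤ i → i < n → x i < x (i + 1)) (hxz : x n < z)
    (hno : ¬ ∃ y, x 1 ≤ n • y ∧ n • y ≤ x n) {w : U} (hw0 : 0 ≤ w) (hw : n • w < x 1) :
    Infinitesimal z w := fun k => by
  have key : ∀ k : ℕ, n • (2 ^ k • w) < x 1 := fun k => by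
    induction k with
    | zero => simpa using hw
    | succ k ih =>
      rw [pow_succ, mul_nsmul]
      exact hreg.double_lt hx hxz hno ih
  calc k • w ≤ 2 ^ k • w := nsmul_le_nsmul_left hw0 Nat.lt_two_pow_self.le
    _ ≤ n • (2 ^ k • w) := le_self_nsmul (nsmul_nonneg hw0 _) (by omega)
    _ < x 1 := key k
    _ ≤ x n := le_of_forall_lt_succ hx le_rfl hn le_rfl
    _ < z := hxz

theorem DivisibleBelowHalf.divisibleBelow {n : ℕ} (hn : 1 ≤ n) {z g : U}
    (hreg : DivisibleBelowHalf n z) (hg : ¬ Infinitesimal z g)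
    (hg' : ¬ Infinitesimal z (z - g)) : DivisibleBelow n z := by
  -- The hypotheses are symmetric in `g` and `z - g`, one of which lies in the lower half.
  wlog h2 : 2 • g ≤ z generalizing g
  · refine this hg' (by rwa [sub_sub_cancel]) ?_
    rw [two_nsmul] at h2 ⊢
    grind
  intro x h0 hx hxz
  by_contra hno
  have hz : z ≤ 2 • x n := by
    by_contra! hz
    exact hno (hreg x h0 hx hz)
  obtain ⟨d, hd0, hd⟩ := exists_pos_nsmul_le h0 hx hn
  have hdi : Infinitesimal z d := hreg.infinitesimal hn hx hxz hno hd0.le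
    (lt_of_not_ge fun h => hno ⟨d, h, hd⟩)
  have hdg : n • d < g := (hdi.nsmul n).lt hg
  -- The terms run from `g - n • d` to `g - d` in steps of `d`: strictly below `g`, hence within the
  -- half bound, and infinitesimally close to it.
  obtain ⟨y, hy1, hy2⟩ := hreg (fun i => g - (n • d + d) + i • d)
    (by
      rw [one_nsmul]
      revert hdg
      generalize n • d = e
      grind)
    (fun i _ _ => by
      rw [succ_nsmul d i]
      generalize i • d = e
      grind)
    (by
      rw [two_nsmul] at h2 ⊢
      generalize n • d = e
      grind)
  have hy1' : g ≤ n • (y + d) := by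
    rw [nsmul_add]
    rw [one_nsmul] at hy1
    revert hy1
    generalize n • d = e
    generalize n • y = e'
    grind
  have hy2' : n • y < g := by
    revert hy2
    generalize n • d = e
    generalize n • y = e'
    grind
  have hy0 : 0 ≤ y := by
    by_contra! hy
    have h1 : n • (y + d) ≤ n • d := nsmul_le_nsmul_right (by grind) n
    exact (hy1'.trans h1).not_gt hdg
  -- Below `x 1`, `y` and hence `g ≤ n • (y + d)` would be infinitesimal; above `x n`, `x n < g`
  -- contradicts `2 • g ≤ z ≤ 2 • x n`.
  rcases lt_or_ge (n • y) (x 1) with h | h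
  · exact hg ((((hreg.infinitesimal hn hx hxz hno hy0 h).add hdi).nsmul n).of_le hy1')
  · have h3 : x n < n • y := lt_of_not_ge fun h' => hno ⟨y, h, h'⟩
    rw [two_nsmul] at hz h2
    grind

end OrderedGroup

/-! ### The winding cocycle and the unwinding. -/

section CircularOrder

variable {G : Type*} [CircularOrder G]

theorem sbtw_or_sbtw_of_ne {a b c : G} (hab : a ≠ b) (hbc : b ≠ c) (hac : a ≠ c) :
    sbtw a b c ∨ sbtw a c b := by
  by_contra! h
  rcases btw_antisymm (btw_iff_not_sbtw.2 h.1) (btw_iff_not_sbtw.2 fun h' => h.2 h'.cyclic_right)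
    with h | h | h <;> grind

open Classical in
/-- The number of extra turns made on the way from `p` to `r` when passing through `q`. -/
noncomputable def turns (p q r : G) : ℤ := if p = q ∨ q = r ∨ sbtw p q r then 0 else 1

theorem turns_nonneg (p q r : G) : 0 ≤ turns p q r := by
  unfold turns; split_ifs <;> simp

/-- The 2-cocycle identity, which makes addition on `Unwound G` associative. -/
theorem turns_add_turns (p q r s : G) :
    turns p q r + turns p r s = turns q r s + turns p q s := by
  have tot := fun a b c : G => @sbtw_or_sbtw_of_ne G _ a b c
  have cyc : ∀ a b c : G, sbtw a b c → sbtw b c a := fun a b c h => h.cyclic_left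
  have asymm : ∀ a b c : G, sbtw a b c → ¬ sbtw c b a := fun a b c h => sbtw_asymm h
  have tr : ∀ a b c d : G, sbtw a b c → sbtw a c d → sbtw a b d :=
    fun a b c d h h' => sbtw_trans_right h h'
  have irr : ∀ a b : G, ¬ sbtw a a b := fun a b => sbtw_irrefl_left
  unfold turns
  by_cases hpq : p = q
  · subst hpq; grind
  by_cases hpr : p = r
  · subst hpr; grind
  by_cases hps : p = s
  · subst hps; grind
  by_cases hqr : q = r
  · subst hqr; grind
  by_cases hqs : q = s
  · subst hqs; grind
  by_cases hrs : r = s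
  · subst hrs; grind
  have h1 := tot p q r hpq hqr hpr
  have h2 := tot p r s hpr hrs hps
  have h3 := tot p q s hpq hqs hps
  have h4 := tot q r s hqr hrs hqs
  split_ifs <;> grind

end CircularOrder

/-- The unwinding of a cyclically ordered group: a linearly ordered group of which `G` is the
quotient by the subgroup generated by a positive cofinal element. -/
@[ext]
structure Unwound (G : Type*) where
  winding : ℤ
  base : G

namespace Unwound

/-- The representative in `[0, turn)`. -/
def lift {G : Type*} (a : G) : Unwound G := ⟨0, a⟩

theorem lift_injective {G : Type*} : Function.Injective (lift : G → Unwound G) := fun _ _ h =>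
  congrArg base h

end Unwound

section Group

variable {G : Type*} [AddCommGroup G] [CircularOrder G]

section IsCyclicallyOrdered

variable [IsCyclicallyOrderedAddGroup G]

theorem sbtw_add_left_iff (u a b c : G) : sbtw (u + a) (u + b) (u + c) ↔ sbtw a b c :=
  ⟨fun h => by simpa using IsCyclicallyOrderedAddGroup.sbtw_add_left (-u) _ _ _ h,
    IsCyclicallyOrderedAddGroup.sbtw_add_left u a b c⟩

theorem sbtw_zero_neg_neg {a b : G} (h : sbtw 0 a b) : sbtw 0 (-b) (-a) := by
  have hab : a ≠ b := by rintro rfl; exact sbtw_irrefl_right h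
  have ha : 0 ≠ a := by rintro rfl; exact sbtw_irrefl_left h
  have hb : 0 ≠ b := by rintro rfl; exact sbtw_irrefl_left_right h
  by_contra hn
  have h' : sbtw 0 (-a) (-b) :=
    (sbtw_or_sbtw_of_ne (by grind) (by grind) (by grind)).resolve_left hn
  have h1 : sbtw 0 (b - a) (-a) := by
    have := (sbtw_add_left_iff (-a) 0 a b).2 h
    rw [show -a + b = b - a by abel, add_zero, neg_add_cancel] at this
    exact this.cyclic_left
  have h2 : sbtw 0 (-b) (a - b) := by
    have := (sbtw_add_left_iff (-b) 0 a b).2 h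
    rw [show -b + a = a - b by abel, add_zero, neg_add_cancel] at this
    exact this.cyclic_right
  have h3 : sbtw 0 (a - b) a := by
    have := (sbtw_add_left_iff a 0 (-a) (-b)).2 h'
    rw [show a + -b = a - b by abel, add_zero, add_neg_cancel] at this
    exact this.cyclic_left
  have h4 : sbtw 0 b (b - a) := by
    have := (sbtw_add_left_iff b 0 (-a) (-b)).2 h'
    rw [show b + -a = b - a by abel, add_zero, add_neg_cancel] at this
    exact this.cyclic_right
  -- Seen from `0`, the chain `a, b, b - a, -a, -b, a - b, a` would be increasing yet return to `a`.
  exact sbtw_irrefl_right <| sbtw_trans_right h <| sbtw_trans_right h4 <| sbtw_trans_right h1 <|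
    sbtw_trans_right h' <| sbtw_trans_right h2 h3

theorem sbtw_zero_add_comm {a b : G} (h : sbtw 0 a (a + b)) : sbtw 0 b (a + b) := by
  have := (sbtw_add_left_iff (a + b) _ _ _).2 (sbtw_zero_neg_neg h)
  rw [add_zero, add_neg_cancel, show a + b + -a = b by abel] at this
  exact this.cyclic_left

open Classical in
theorem turns_add_comm (a b : G) : turns 0 a (a + b) = turns 0 b (a + b) := by
  have h : sbtw 0 a (a + b) ↔ sbtw 0 b (a + b) :=
    ⟨sbtw_zero_add_comm, fun h => by rw [add_comm] at h ⊢; exact sbtw_zero_add_comm h⟩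
  refine if_congr ?_ rfl rfl
  rw [h, left_eq_add, right_eq_add, eq_comm (b := a), eq_comm (b := b), or_left_comm]

open Classical in
theorem turns_add_left (u a b c : G) : turns (u + a) (u + b) (u + c) = turns a b c :=
  if_congr (by simp [sbtw_add_left_iff]) rfl rfl

end IsCyclicallyOrdered

namespace Unwound

section Zero

variable {G : Type*} [Zero G]

instance : Zero (Unwound G) := ⟨⟨0, 0⟩⟩

@[simp] theorem winding_zero : (0 : Unwound G).winding = 0 := rfl
@[simp] theorem base_zero : (0 : Unwound G).base = 0 := rfl
@[simp] theorem lift_zero : lift (0 : G) = 0 := rfl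

end Zero

noncomputable instance : Add (Unwound G) :=
  ⟨fun u v => ⟨u.winding + v.winding + turns 0 u.base (u.base + v.base), u.base + v.base⟩⟩

noncomputable instance : Neg (Unwound G) :=
  ⟨fun u => ⟨-u.winding - turns 0 u.base 0, -u.base⟩⟩

@[simp] theorem winding_add (u v : Unwound G) : (u + v).winding =
    u.winding + v.winding + turns 0 u.base (u.base + v.base) := rfl
@[simp] theorem base_add (u v : Unwound G) : (u + v).base = u.base + v.base := rfl
@[simp] theorem winding_neg (u : Unwound G) :
    (-u).winding = -u.winding - turns 0 u.base 0 := rfl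
@[simp] theorem base_neg (u : Unwound G) : (-u).base = -u.base := rfl

variable [IsCyclicallyOrderedAddGroup G]

noncomputable instance : AddCommGroup (Unwound G) where
  add_assoc u v w := by
    ext
    · have h := turns_add_turns 0 u.base (u.base + v.base) (u.base + v.base + w.base)
      have h' := turns_add_left u.base 0 v.base (v.base + w.base)
      rw [add_zero, ← add_assoc] at h'
      simp only [winding_add, base_add, ← add_assoc]
      linarith
    · exact add_assoc _ _ _
  zero_add u := by ext <;> simp [turns]
  add_zero u := by ext <;> simp [turns]
  neg_add_cancel u := by
    ext
    · have := turns_add_comm u.base (-u.base)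
      simp only [add_neg_cancel] at this
      simp [this]
      ring
    · simp
  add_comm u v := by
    ext
    · simp only [winding_add]
      rw [add_comm v.base, turns_add_comm u.base]
      ring
    · exact add_comm _ _
  nsmul := nsmulRec
  zsmul := zsmulRec

variable (G) in
/-- The elements of nonnegative winding. -/
noncomputable def cone : AddGroupCone (Unwound G) where
  carrier := {u | 0 ≤ u.winding}
  zero_mem' := by simp
  add_mem' {u v} hu hv := by
    have := turns_nonneg 0 u.base (u.base + v.base)
    simp only [Set.mem_ofPred_eq, winding_add] at *
    omega
  eq_zero_of_mem_of_neg_mem' {u} hu hv := by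
    have := turns_nonneg 0 u.base 0
    simp only [Set.mem_ofPred_eq, winding_neg] at *
    have h0 : turns 0 u.base 0 = 0 := by omega
    ext
    · simp only [winding_zero]; omega
    · by_contra hb
      have hb' : u.base ≠ 0 := hb
      simp [turns, hb', hb'.symm, sbtw_irrefl_left_right] at h0

theorem mem_cone {u : Unwound G} : u ∈ cone G ↔ 0 ≤ u.winding :=
  Set.mem_ofPred_eq ▸ Iff.rfl

instance : HasMemOrNegMem (cone G) where
  mem_or_neg_mem u := by
    simp only [mem_cone, winding_neg]
    unfold turns
    split_ifs <;> omega

open Classical in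
noncomputable instance : LinearOrder (Unwound G) := LinearOrder.mkOfAddGroupCone (cone G)

instance : IsOrderedAddMonoid (Unwound G) := IsOrderedAddMonoid.mkOfCone (cone G)

theorem le_iff {u v : Unwound G} : u ≤ v ↔ 0 ≤ (v - u).winding := mem_cone

theorem nonneg_iff {u : Unwound G} : 0 ≤ u ↔ 0 ≤ u.winding := by rw [le_iff, sub_zero]

variable (G) in
/-- The full turn. -/
def turn : Unwound G := ⟨1, 0⟩

theorem winding_sub_turn (u : Unwound G) : (u - turn G).winding = u.winding - 1 := by
  rw [sub_eq_add_neg]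
  simp [turn, turns]
  ring

theorem turn_le_iff {u : Unwound G} : turn G ≤ u ↔ 1 ≤ u.winding := by
  rw [le_iff, winding_sub_turn]; omega

variable (G) in
/-- The quotient map. -/
noncomputable def proj : Unwound G →+ G where
  toFun := base
  map_zero' := rfl
  map_add' _ _ := rfl

@[simp] theorem proj_lift (a : G) : proj G (lift a) = a := rfl
@[simp] theorem proj_turn : proj G (turn G) = 0 := rfl

theorem lift_nonneg (a : G) : 0 ≤ lift a := nonneg_iff.2 le_rfl

theorem lift_lt_turn (a : G) : lift a < turn G := by
  rw [← not_le, turn_le_iff]; simp [lift]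

theorem lift_proj {u : Unwound G} (h0 : 0 ≤ u) (h1 : u < turn G) : lift (proj G u) = u := by
  rw [nonneg_iff] at h0
  rw [← not_le, turn_le_iff] at h1
  ext
  · simp only [lift]; omega
  · rfl

theorem lift_pos {a : G} (h : a ≠ 0) : 0 < lift a :=
  (lift_nonneg a).lt_of_ne' fun h' => h (lift_injective h')

theorem lift_neg {a : G} (h : a ≠ 0) : lift (-a) = turn G - lift a := by
  have h1 := lift_pos h
  have h2 := lift_lt_turn a
  rw [← lift_proj (u := turn G - lift a) (by grind) (by grind)]
  simp

theorem lift_add {a b : G} (h : lift a + lift b < turn G) : lift (a + b) = lift a + lift b := by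
  rw [← lift_proj (add_nonneg (lift_nonneg a) (lift_nonneg b)) h]
  simp

/-- Had the sum wrapped around, it would equal `lift a + lift b - turn G < lift a`. -/
theorem lift_add_of_le {a b : G} (h : lift a ≤ lift (a + b)) :
    lift (a + b) = lift a + lift b := by
  by_contra hne
  have h' : turn G ≤ lift a + lift b := not_lt.1 fun h => hne (lift_add h)
  have ha := lift_lt_turn a
  have hb := lift_lt_turn b
  have := lift_proj (u := lift a + lift b - turn G) (by grind) (by grind)
  simp at this
  grind

theorem sbtw_zero_iff {a b : G} : sbtw 0 a b ↔ 0 < lift a ∧ lift a < lift b := by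
  have key : ∀ {a b : G}, sbtw 0 a b → lift a < lift b := fun {a b} h => by
    have hab : a ≠ b := by rintro rfl; exact sbtw_irrefl_right h
    have e : lift b = lift a + lift (b - a) := by
      ext
      · simp [lift, turns, h]
      · simp [lift]
    rw [e]
    exact lt_add_of_pos_right _ (lift_pos (sub_ne_zero.2 hab.symm))
  refine ⟨fun h => ⟨lift_pos ?_, key h⟩, fun ⟨h1, h2⟩ => ?_⟩
  · rintro rfl; exact sbtw_irrefl_left h
  · refine (sbtw_or_sbtw_of_ne ?_ ?_ ?_).resolve_right fun h => (key h).not_gt h2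
    · rintro rfl; exact h1.ne rfl
    · rintro rfl; exact h2.ne rfl
    · rintro rfl; exact (h1.trans h2).ne rfl

end Unwound

end Group

/-! ### Cyclic chains and division as conditions on triples. -/

theorem pairwise_range'_one {m : ℕ} {S : ℕ → ℕ → Prop} :
    (List.range' 1 m).Pairwise S ↔ ∀ i j, 1 ≤ i → i < j → j ≤ m → S i j := by
  rw [List.pairwise_iff_getElem]
  simp only [List.length_range', List.getElem_range', one_mul]
  refine ⟨fun h i j hi hij hj => ?_, fun h i j hi hj hij => h _ _ (by omega) (by omega) (by omega)⟩
  have := h (i - 1) (j - 1) (by omega) (by omega) (by omega)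
  rwa [Nat.add_sub_cancel' hi, Nat.add_sub_cancel' (by omega)] at this

section CircularOrder

variable {G : Type*} [CircularOrder G]

theorem sbtw_of_sbtw_of_sbtw {p a b c : G} (h : sbtw p a b) (h' : sbtw p b c) : sbtw a b c :=
  (sbtw_trans_right h'.cyclic_left h.cyclic_right).cyclic_right

/-- Cutting the circle at `p` leaves a linear order, so triples through `p` determine the rest. -/
theorem cycChain_cons {p : G} {l : List G} : CycChain (p :: l) ↔ l.Pairwise (sbtw p) := by
  rw [CycChain, List.triplewise_cons, and_iff_left_iff_imp]
  intro h
  induction h with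
  | nil => exact .nil
  | cons h1 h2 ih =>
    refine .cons ?_ ih
    exact h2.imp_of_mem fun hb _ hbc => sbtw_of_sbtw_of_sbtw (h1 _ hb) hbc

theorem cycChain_cons_map {p : G} {m : ℕ} {f : ℕ → G} :
    CycChain (p :: (List.range' 1 m).map f) ↔
      ∀ i j, 1 ≤ i → i < j → j ≤ m → sbtw p (f i) (f j) := by
  rw [cycChain_cons, List.pairwise_map, pairwise_range'_one]

theorem cycChain_cons_map_append {p c : G} {m : ℕ} {f : ℕ → G} :
    CycChain (p :: ((List.range' 1 m).map f ++ [c])) ↔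
      (∀ i j, 1 ≤ i → i < j → j ≤ m → sbtw p (f i) (f j)) ∧
        ∀ i, 1 ≤ i → i ≤ m → sbtw p (f i) c := by
  rw [cycChain_cons, List.pairwise_append, List.pairwise_map, pairwise_range'_one]
  simp only [List.pairwise_singleton, List.forall_mem_map, List.mem_range'_1, List.mem_singleton,
    forall_eq, true_and, and_imp, add_comm 1 m, Nat.lt_succ_iff]

theorem sbtw_iff_of_injective {U : Type*} [LinearOrder U] {f : G → U}
    (hf : Function.Injective f) (h : ∀ a b c, f a < f b → f b < f c → sbtw a b c) (a b c : G) :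
    sbtw a b c ↔ (f a < f b ∧ f b < f c) ∨ (f b < f c ∧ f c < f a) ∨ (f c < f a ∧ f a < f b) := by
  constructor
  · intro hs
    have hab : f a ≠ f b := fun e => by
      rw [hf e] at hs; exact sbtw_irrefl_left hs
    have hbc : f b ≠ f c := fun e => by
      rw [hf e] at hs; exact sbtw_irrefl_right hs
    have hac : f a ≠ f c := fun e => by
      rw [hf e] at hs; exact sbtw_irrefl_left_right hs
    have h1 := fun h1 h2 => sbtw_asymm hs (h c b a h1 h2)
    have h2 := fun h1 h2 => sbtw_asymm hs (h b a c h1 h2).cyclic_right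
    have h3 := fun h1 h2 => sbtw_asymm hs (h a c b h1 h2).cyclic_left
    clear h
    rcases lt_or_gt_of_ne hab with hab | hab <;> rcases lt_or_gt_of_ne hbc with hbc | hbc <;>
      rcases lt_or_gt_of_ne hac with hac | hac <;> simp_all [lt_asymm]
  · rintro (⟨h1, h2⟩ | ⟨h1, h2⟩ | ⟨h1, h2⟩)
    · exact h _ _ _ h1 h2
    · exact (h _ _ _ h1 h2).cyclic_right
    · exact (h _ _ _ h1 h2).cyclic_left

end CircularOrder

section Division

variable {G : Type*} [AddCommGroup G] [CircularOrder G]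

theorem hasCycDivision_iff {n : ℕ} (hn : 1 ≤ n) {a b : G} : HasCycDivision n a b ↔
    ∃ x : G, (sbtw a (n • x) b ∨ n • x = a ∨ n • x = b) ∧
      (∀ i j, 1 ≤ i → i < j → j < n → sbtw 0 (i • x) (j • x)) ∧
        ∀ i, 1 ≤ i → i < n → sbtw 0 (i • x) b := by
  obtain ⟨m, rfl⟩ : ∃ m, n = m + 1 := ⟨n - 1, by omega⟩
  simp only [HasCycDivision, List.range_eq_range', List.range'_succ, List.map_cons, zero_nsmul,
    List.cons_append, cycChain_cons_map_append, zero_add, Nat.lt_succ_iff]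

/-- Serves both cases: `f` is the identity for a linear order and `proj G` for the unwinding. -/
theorem hasCycDivision_map {U : Type*} [AddCommGroup U] [LinearOrder U] [IsOrderedAddMonoid U]
    (f : U →+ G) {n : ℕ} (hn : 1 ≤ n) {a b y : U}
    (hf : ∀ u v w, 0 ≤ u → u < v → v < w → w ≤ b → sbtw (f u) (f v) (f w))
    (ha : 0 < a) (h1 : a ≤ n • y) (h2 : n • y ≤ b) : HasCycDivision n (f a) (f b) := by
  have hy : 0 < y := by
    by_contra! hy
    exact (ha.trans_le h1).not_ge (nsmul_nonpos hy n)
  have hlt : ∀ {i j : ℕ}, i < j → i • y < j • y := fun h => nsmul_lt_nsmul_left hy h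
  have hpos : ∀ {i : ℕ}, 1 ≤ i → 0 < i • y := fun h => nsmul_pos hy (by omega)
  rw [hasCycDivision_iff hn]
  refine ⟨f y, ?_, fun i j hi hij hj => ?_, fun i hi hin => ?_⟩
  · rw [← map_nsmul]
    rcases h1.eq_or_lt with h1 | h1
    · exact .inr (.inl (by rw [h1]))
    rcases h2.eq_or_lt with h2 | h2
    · exact .inr (.inr (by rw [h2]))
    exact .inl (hf _ _ _ ha.le h1 h2 le_rfl)
  · rw [← map_nsmul, ← map_nsmul, ← map_zero f]
    exact hf _ _ _ le_rfl (hpos hi) (hlt hij) ((hlt hj).le.trans h2)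
  · rw [← map_nsmul, ← map_zero f]
    exact hf _ _ _ le_rfl (hpos hi) ((hlt hin).trans_le h2) le_rfl

end Division

/-! ### The linearly cyclically ordered case. -/

section Induced

variable {G : Type*} [AddCommGroup G] [CircularOrder G] [LinearOrder G]

theorem IsInducedByLinearOrder.isNRegular_iff (h : IsInducedByLinearOrder G) {n : ℕ}
    (hn : 2 ≤ n) : IsNRegular G n ↔ IsNRegularLinear G n := by
  have := h.isOrdered
  have hs := h.sbtw_iff
  refine ⟨fun hreg x h0 hx => ?_, fun hreg x hx => ?_⟩
  · have hpos : ∀ i, 1 ≤ i → i ≤ n → 0 < x i := fun i hi hin =>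
      h0.trans_le (le_of_forall_lt_succ hx le_rfl hi hin)
    have hneg : -x n < 0 := neg_neg_of_pos (hpos n (by omega) le_rfl)
    obtain ⟨y, hy, -⟩ := hreg x <| cycChain_cons_map_append.2
      ⟨fun i j hi hij hj => (hs _ _ _).2 (.inl ⟨hpos i hi (by omega),
        lt_of_forall_lt_succ hx hi hij hj⟩),
        fun i hi hin => (hs _ _ _).2 (.inr (.inr ⟨hneg, hpos i hi hin⟩))⟩
    have hlt := lt_of_forall_lt_succ hx le_rfl (show 1 < n by omega) le_rfl
    refine ⟨y, ?_⟩
    rw [hs] at hy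
    grind
  · obtain ⟨hx1, hx2⟩ := cycChain_cons_map_append.1 hx
    have hn0 : 0 < x n := by
      have := (hs _ _ _).1 (hx2 n (by omega) le_rfl)
      by_contra! h0
      have h1 := neg_nonneg.2 h0
      grind
    have hpos : ∀ i, 1 ≤ i → i ≤ n → 0 < x i := fun i hi hin => by
      rcases hin.eq_or_lt with rfl | hin
      · exact hn0
      have := (hs _ _ _).1 (hx1 i n hi hin le_rfl)
      grind
    obtain ⟨y, hy1, hy2⟩ := hreg x (hpos 1 le_rfl (by omega)) fun i hi hin => by
      have := (hs _ _ _).1 (hx1 i (i + 1) hi (by omega) (by omega))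
      have := hpos (i + 1) (by omega) (by omega)
      grind
    exact hasCycDivision_map (AddMonoidHom.id G) (by omega)
      (fun u v w _ h1 h2 _ => (hs _ _ _).2 (.inl ⟨h1, h2⟩)) (hpos 1 le_rfl (by omega)) hy1 hy2

end Induced

/-! ### Transfer between `G` and its unwinding. -/

section Unwound

open Unwound

variable {G : Type*} [AddCommGroup G] [CircularOrder G] [IsCyclicallyOrderedAddGroup G]

theorem Unwound.sbtw_of_lift_lt_lift (a b c : G) (h : lift a < lift b) (h' : lift b < lift c) :
    sbtw a b c := by
  have hb := sbtw_zero_iff.2 ⟨(lift_nonneg a).trans_lt h, h'⟩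
  rcases eq_or_ne a 0 with rfl | ha
  · exact hb
  · exact sbtw_of_sbtw_of_sbtw (sbtw_zero_iff.2 ⟨lift_pos ha, h⟩) hb

theorem Unwound.sbtw_proj {u v w : Unwound G} (h0 : 0 ≤ u) (h1 : u < v) (h2 : v < w)
    (h3 : w < turn G) : sbtw (proj G u) (proj G v) (proj G w) := by
  apply sbtw_of_lift_lt_lift <;> rw [lift_proj, lift_proj] <;> grind

theorem DivisibleBelow.isCNRegular {n : ℕ} (hn : 2 ≤ n) (h : DivisibleBelow n (turn G)) :
    IsCNRegular G n := by
  intro x hx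
  have hx := cycChain_cons_map.1 hx
  simp only [sbtw_zero_iff] at hx
  have h0 := (hx 1 n le_rfl (by omega) le_rfl).1
  obtain ⟨y, hy1, hy2⟩ := h (fun i => lift (x i)) h0
    (fun i hi hin => (hx i (i + 1) hi (by omega) (by omega)).2) (lift_lt_turn _)
  have := hasCycDivision_map (proj G) (by omega) (fun u v w h0 h1 h2 h3 =>
    sbtw_proj h0 h1 h2 (h3.trans_lt (lift_lt_turn _))) h0 hy1 hy2
  simpa using this

theorem HasCycDivision.exists_nsmul {n : ℕ} (hn : 2 ≤ n) {a b : G} (h : HasCycDivision n a b)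
    (hab : lift a < lift b) (hb : 2 • lift b < turn G) :
    ∃ y, lift a ≤ n • y ∧ n • y ≤ lift b := by
  obtain ⟨x, hx, hx1, hx2⟩ := (hasCycDivision_iff (by omega)).1 h
  simp only [sbtw_zero_iff] at hx1 hx2
  have key : ∀ i, 1 ≤ i → i < n → lift (i • x) = i • lift x := fun i hi => by
    induction i, hi using Nat.le_induction with
    | base => simp
    | succ i hi ih =>
      intro hin
      have hle := (hx1 i (i + 1) hi (by omega) hin).2.le
      rw [succ_nsmul] at hle
      rw [succ_nsmul, succ_nsmul, ← ih (by omega)]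
      exact lift_add_of_le hle
  obtain ⟨m, rfl⟩ : ∃ m, n = m + 1 := ⟨n - 1, by omega⟩
  -- The chain does not control the last multiple; `lift (m • x)` and `lift x` are both below `lift
  -- b`, so `hb` prevents wrapping.
  have hn : lift ((m + 1) • x) = (m + 1) • lift x := by
    rw [succ_nsmul, succ_nsmul, ← key m (by omega) (by omega)]
    apply lift_add
    have h1 := (hx2 1 le_rfl (by omega)).2
    have h2 := (hx2 m (by omega) (by omega)).2
    rw [one_nsmul] at h1
    rw [two_nsmul] at hb
    grind
  refine ⟨lift x, ?_⟩
  rw [← hn]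
  rcases hx with hx | hx | hx
  · rw [sbtw_iff_of_injective lift_injective sbtw_of_lift_lt_lift] at hx
    grind
  · rw [hx]; exact ⟨le_rfl, hab.le⟩
  · rw [hx]; exact ⟨hab.le, le_rfl⟩

theorem IsNRegular.divisibleBelowHalf {n : ℕ} (hn : 2 ≤ n) (h : IsNRegular G n) :
    DivisibleBelowHalf n (turn G) := by
  intro x h0 hx hz
  have hpos : ∀ i, 1 ≤ i → i ≤ n → 0 < x i := fun i hi hin =>
    h0.trans_le (le_of_forall_lt_succ hx le_rfl hi hin)
  have hlt : ∀ i, 1 ≤ i → i ≤ n → x i < turn G := fun i hi hin => by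
    have h1 := le_of_forall_lt_succ hx hi hin le_rfl
    have h2 := hpos n (by omega) le_rfl
    rw [two_nsmul] at hz
    grind
  have hl : ∀ i, 1 ≤ i → i ≤ n → lift (proj G (x i)) = x i := fun i hi hin =>
    lift_proj (hpos i hi hin).le (hlt i hi hin)
  have hn1 := hl n (by omega) le_rfl
  have hne : proj G (x n) ≠ 0 := fun e => by
    rw [e, lift_zero] at hn1
    exact (hpos n (by omega) le_rfl).ne hn1
  have hdiv := h (fun i => proj G (x i)) <| cycChain_cons_map_append.2
    ⟨fun i j hi hij hj => by
      rw [sbtw_zero_iff, hl i hi (by omega), hl j (by omega) hj]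
      exact ⟨hpos i hi (by omega), lt_of_forall_lt_succ hx hi hij hj⟩,
    fun i hi hin => by
      -- The term `-xₙ` lifts to `turn G - x n`, which exceeds `x n` by `hz`.
      rw [sbtw_zero_iff, lift_neg hne, hn1, hl i hi hin]
      refine ⟨hpos i hi hin, ?_⟩
      have h1 := le_of_forall_lt_succ hx hi hin le_rfl
      rw [two_nsmul] at hz
      grind⟩
  have h1 := hl 1 le_rfl (by omega)
  have := hdiv.exists_nsmul hn
    (by rw [h1, hn1]; exact lt_of_forall_lt_succ hx le_rfl (by omega) le_rfl) (by rwa [hn1])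
  rwa [h1, hn1] at this

theorem Unwound.turn_pos : 0 < turn G := lift_zero (G := G) ▸ lift_lt_turn 0

variable (G) in
/-- The elements represented by infinitesimals. -/
noncomputable def infinitesimalCone : AddGroupCone G where
  carrier := {a | Infinitesimal (turn G) (lift a)}
  zero_mem' := by simp [Infinitesimal, turn_pos]
  add_mem' {a b} ha hb := by
    simp only [Set.mem_ofPred_eq] at *
    have h := ha.add hb
    rwa [lift_add (by simpa using h 1)]
  eq_zero_of_mem_of_neg_mem' {a} ha hb := by
    simp only [Set.mem_ofPred_eq] at *
    by_contra h
    rw [lift_neg h] at hb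
    have := ha.add hb 1
    simp at this

theorem mem_infinitesimalCone {a : G} :
    a ∈ infinitesimalCone G ↔ Infinitesimal (turn G) (lift a) :=
  Set.mem_ofPred_eq ▸ Iff.rfl

-- The hypothesis makes the infinitesimal cone total. For `a < b < c` the lifts of `b - a` and `c -
-- b` add without wrapping, so the orders agree.
open Classical in
theorem isLinearlyCyclicallyOrdered_of_infinitesimal
    (h : ∀ g : Unwound G, Infinitesimal (turn G) g ∨ Infinitesimal (turn G) (turn G - g)) :
    IsLinearlyCyclicallyOrdered G := by
  have : HasMemOrNegMem (infinitesimalCone G) := ⟨fun a => by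
    rw [mem_infinitesimalCone, mem_infinitesimalCone]
    rcases eq_or_ne a 0 with rfl | ha
    · exact .inl fun k => by simpa using turn_pos
    · rw [lift_neg ha]; exact h _⟩
  let o : LinearOrder G := LinearOrder.mkOfAddGroupCone (infinitesimalCone G)
  refine ⟨o, IsOrderedAddMonoid.mkOfCone (infinitesimalCone G),
    sbtw_iff_of_injective Function.injective_id fun a b c hab hbc => ?_⟩
  have h1 : Infinitesimal (turn G) (lift (b - a)) := mem_infinitesimalCone.1 hab.le
  have h2 : Infinitesimal (turn G) (lift (c - b)) := mem_infinitesimalCone.1 hbc.le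
  have h3 := lift_add (by simpa using h1.add h2 1)
  have h4 := lift_pos (sub_ne_zero.2 hab.ne')
  have h5 := lift_pos (sub_ne_zero.2 hbc.ne')
  have h6 : sbtw 0 (b - a) (b - a + (c - b)) :=
    sbtw_zero_iff.2 ⟨h4, by rw [h3]; exact lt_add_of_pos_right _ h5⟩
  simpa using (sbtw_add_left_iff a _ _ _).2 h6

theorem IsNRegular.isCNRegular {n : ℕ} (hn : 2 ≤ n) (h : IsNRegular G n)
    (hG : ¬ IsLinearlyCyclicallyOrdered G) : IsCNRegular G n := by
  obtain ⟨g, hg⟩ := not_forall.1 (mt isLinearlyCyclicallyOrdered_of_infinitesimal hG)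
  rw [not_or] at hg
  exact ((h.divisibleBelowHalf hn).divisibleBelow (by omega) hg.1 hg.2).isCNRegular hn

end Unwound

theorem IsCNRegular.isNRegular {G : Type*} [AddCommGroup G] [CircularOrder G] {n : ℕ}
    (h : IsCNRegular G n) : IsNRegular G n := fun x hx =>
  h x (cycChain_cons_map.2 (cycChain_cons_map_append.1 hx).1)

end CyclicOrd

theorem mainTheorem8 {G : Type*} [AddCommGroup G] [CircularOrder G]
    [CyclicOrd.IsCyclicallyOrderedAddGroup G] (n : ℕ) (hn : 2 ≤ n) :
    (CyclicOrd.IsNRegular G n ↔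
      CyclicOrd.IsNRegularLinearlyOrdered G n ∨
        (¬ CyclicOrd.IsLinearlyCyclicallyOrdered G ∧ CyclicOrd.IsCNRegular G n)) ∧
    (CyclicOrd.IsNRegular G n ↔
      CyclicOrd.IsNRegularLinearlyOrdered G n ∨ CyclicOrd.IsCNRegular G n) := by
  have h1 : CyclicOrd.IsNRegular G n → CyclicOrd.IsNRegularLinearlyOrdered G n ∨
      (¬ CyclicOrd.IsLinearlyCyclicallyOrdered G ∧ CyclicOrd.IsCNRegular G n) := fun h => by
    by_cases hG : CyclicOrd.IsLinearlyCyclicallyOrdered G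
    · obtain ⟨o, ho⟩ := hG
      exact .inl ⟨o, ho, (ho.isNRegular_iff hn).1 h⟩
    · exact .inr ⟨hG, h.isCNRegular hn hG⟩
  have h2 : CyclicOrd.IsNRegularLinearlyOrdered G n ∨ CyclicOrd.IsCNRegular G n →
      CyclicOrd.IsNRegular G n := by
    rintro (⟨_, ho, h⟩ | h)
    · exact (ho.isNRegular_iff hn).2 h
    · exact h.isNRegular
  exact ⟨⟨h1, fun h => h2 (h.imp_right And.right)⟩, fun h => (h1 h).imp_right And.right, h2⟩
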